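/- Let $E$ be a finite-dimensional real vector space with dual space $E^*$, and let $K\subset E$ be a regular cone, i.e. a closed convex cone that contains no line and has nonempty interior. Let $K^*=\{s\in E^*:\ \langle s,x\rangle\ge 0\ \text{for all } x\in K\}$ be its dual cone. For a real number $\nu$, let $F:\operatorname{int}K\to\mathbb R$ be a $\nu$-normal barrier for $K$: $F$ is convex and three times continuously differentiable, $F(x_k)\to+\infty$ whenever $x_k\in\operatorname{int}K$ converges to a boundary point of $K$, $$|\nabla^3F(x)[h,h,h]|\le 2\,\bigl(\nabla^2F(x)[h,h]\bigr)^{3/2}\qquad (x\in\operatorname{int}K,\ h\in E),$$ and $F(\tau x)=F(x)-\nu\ln\tau$ for all $x\in\operatorname{int}K$ and $\tau>0$. Let $$F_*(s)=\sup_{x\in\operatorname{int}K}\{-\langle s,x\rangle-F(x)\},\qquad s\in\operatorname{int}K^*,$$ be the dual (conjugate) barrier for $K^*$. A barrier $\Phi$ for a cone $C$ is said to have negative curvature if $\nabla^3\Phi(x)[h,u,u]\le 0$ for all $x\in\operatorname{int}C$, all $h\in C$ and all vectors $u$ of the ambient space of $C$. If both $F$ (as a barrier for $K$) and $F_*$ (as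 a barrier for $K^*$) have negative curvature, then $K$ is a symmetric cone, that is: 1. $K$ is homogeneous: for all $x,y\in\operatorname{int}K$ there is an invertible linear map $A:E\to E$ with $A(K)=K$ and $Ax=y$; 2. $K$ is self-dual: there is an inner product $(\cdot,\cdot)$ on $E$ such that $K=\{y\in E:\ (x,y)\ge 0\ \text{for all }x\in K\}$. -/

import Mathlib

open Set Filter Topology

/-- A regular cone: a closed convex cone (`ProperCone`) that contains no line and has nonempty
interior. -/
structure IsRegularCone {E : Type*} [NormedAddCommGroup E] [NormedSpace ℝ E]
    (K : ProperCone ℝ E) : Prop where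
  salient : ∀ x ∈ K, -x ∈ K → x = 0
  interior_nonempty : (interior (K : Set E)).Nonempty

/-- The dual cone `{s ∈ E* | ⟨s, x⟩ ≥ 0 for all x ∈ K}` as a closed convex cone in `E*`. -/
noncomputable def dualCone {E : Type*} [NormedAddCommGroup E] [NormedSpace ℝ E]
    [FiniteDimensional ℝ E] (K : ProperCone ℝ E) : ProperCone ℝ (StrongDual ℝ E) :=
  ProperCone.dual (topDualPairing ℝ E).flip (K : Set E)

/-- Membership in the dual cone, spelled out. -/
theorem mem_dualCone {E : Type*} [NormedAddCommGroup E] [NormedSpace ℝ E]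
    [FiniteDimensional ℝ E] (K : ProperCone ℝ E) (s : StrongDual ℝ E) : s ∈ dualCone K ↔ ∀ x ∈ K, 0 ≤ s x :=
  Iff.rfl

/-- A (standard, closed) self-concordant function on the interior of `Q`: convex, three times
continuously differentiable, tending to `+∞` at the boundary of `Q`, with
`|D³F(x)[h,h,h]| ≤ 2 (D²F(x)[h,h])^{3/2}`. Values of `F` off `interior Q` are irrelevant. -/
structure IsSelfConcordant {E : Type*} [NormedAddCommGroup E] [NormedSpace ℝ E]
    (Q : Set E) (F : E → ℝ) : Prop where
  convexOn : ConvexOn ℝ (interior Q) F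
  contDiffOn : ContDiffOn ℝ 3 F (interior Q)
  tendsto_atTop : ∀ x ∈ frontier Q, Tendsto F (𝓝[interior Q] x) atTop
  third_le : ∀ x ∈ interior Q, ∀ h : E,
    |iteratedFDeriv ℝ 3 F x ![h, h, h]| ≤
      2 * (iteratedFDeriv ℝ 2 F x ![h, h]) ^ (3 / 2 : ℝ)

/-- A `ν`-normal barrier for the cone `K`: self-concordant on the interior of `K` and
`ν`-logarithmically homogeneous. -/
structure IsNormalBarrier {E : Type*} [NormedAddCommGroup E] [NormedSpace ℝ E]
    (K : ProperCone ℝ E) (ν : ℝ) (F : E → ℝ) : Prop where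
  selfConcordant : IsSelfConcordant (K : Set E) F
  logHomogeneous : ∀ x ∈ interior (K : Set E), ∀ τ : ℝ, 0 < τ →
    F (τ • x) = F x - ν * Real.log τ

/-- The dual barrier `F_*(s) = sup {-⟨s, x⟩ - F(x) | x ∈ interior K}`; only its values on the
interior of the dual cone, where the supremum is finite, matter. -/
noncomputable def dualBarrier {E : Type*} [NormedAddCommGroup E] [NormedSpace ℝ E]
    (K : ProperCone ℝ E) (F : E → ℝ) (s : StrongDual ℝ E) : ℝ :=
  sSup ((fun x : E => -s x - F x) '' interior (K : Set E))

/-- Negative curvature: for `x ∈ interior K` and `h ∈ K` the quadratic form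
`u ↦ D³F(x)[h,u,u]` is negative semidefinite. -/
def HasNegativeCurvature {E : Type*} [NormedAddCommGroup E] [NormedSpace ℝ E]
    (K : ProperCone ℝ E) (F : E → ℝ) : Prop :=
  ∀ x ∈ interior (K : Set E), ∀ h ∈ K, ∀ u : E, iteratedFDeriv ℝ 3 F x ![h, u, u] ≤ 0

/-- Homogeneity: the linear automorphisms of `K` act transitively on its interior. -/
def IsHomogeneousCone {E : Type*} [NormedAddCommGroup E] [NormedSpace ℝ E]
    (K : ProperCone ℝ E) : Prop :=
  ∀ x ∈ interior (K : Set E), ∀ y ∈ interior (K : Set E),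
    ∃ A : E ≃ₗ[ℝ] E, A '' (K : Set E) = (K : Set E) ∧ A x = y

/-- Self-duality: for some inner product `B` on `E`, the cone `K` equals its dual with respect
to `B`. -/
def IsSelfDualCone {E : Type*} [NormedAddCommGroup E] [NormedSpace ℝ E]
    (K : ProperCone ℝ E) : Prop :=
  ∃ B : E →ₗ[ℝ] E →ₗ[ℝ] ℝ, (∀ x y, B x y = B y x) ∧ (∀ x, x ≠ 0 → 0 < B x x) ∧
    ∀ y, y ∈ K ↔ ∀ x ∈ K, 0 ≤ B x y

/-- A symmetric cone: a regular cone that is homogeneous and self-dual. -/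
structure IsSymmetricCone {E : Type*} [NormedAddCommGroup E] [NormedSpace ℝ E]
    (K : ProperCone ℝ E) : Prop where
  regular : IsRegularCone K
  homogeneous : IsHomogeneousCone K
  selfDual : IsSelfDualCone K

/-! The Hessian `D²F(x)` carries `K` onto `K*`, and both conclusions follow from this. Negative
curvature makes `D²F(x+th)[h,v]` nonincreasing in `t` for `h, v ∈ K`. A negative initial value would
drive `DF(x+th)[v]` to `-∞`, whereas homogeneity of degree `-1` forces it to `0`. So `D²F(x)` maps
`K` into `K*` (`HasNegativeCurvature.hessian_nonneg`). The same argument applies to `F_*`, whose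
Hessian at `-DF(x)` is `D²F(x)⁻¹`, and gives the reverse inclusion (`hessian_mem_dualCone_iff`).

Self-duality: `D²F(x)` is itself the inner product, definite by `hessian_nondegenerate`.

Homogeneity: minimizing `w ↦ s(w) - DF(w)[x]` yields a scaling point `w` with `D²F(w)x = s`
(`exists_hessian_apply_eq`). For `s = -DF(y) = D²F(y)y`, the map `D²F(y)⁻¹ D²F(w)` preserves `K` and
sends `x` to `y`. -/

/-! ### Interiors of closed convex cones. -/

section Cone

open scoped Pointwise

variable {V : Type*} [NormedAddCommGroup V] [NormedSpace ℝ V] {C : ProperCone ℝ V}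

theorem ProperCone.add_mem_interior {x h : V} (hx : x ∈ interior (C : Set V)) (hh : h ∈ C) :
    x + h ∈ interior (C : Set V) := by
  have hsub : interior (C : Set V) + ({h} : Set V) ⊆ (C : Set V) := by
    rintro _ ⟨y, hy, z, rfl, rfl⟩
    exact C.add_mem (interior_subset hy) hh
  exact interior_maximal hsub isOpen_interior.add_right (Set.add_mem_add hx rfl)

theorem ProperCone.smul_mem_interior {x : V} {t : ℝ} (hx : x ∈ interior (C : Set V))
    (ht : 0 < t) : t • x ∈ interior (C : Set V) := by
  have hsub : t • interior (C : Set V) ⊆ (C : Set V) := by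
    rintro _ ⟨y, hy, rfl⟩
    exact C.smul_mem (interior_subset hy) ht.le
  exact interior_maximal hsub (isOpen_interior.smul₀ ht.ne') (Set.smul_mem_smul_set hx)

theorem ProperCone.convex_coe (C : ProperCone ℝ V) : Convex ℝ (C : Set V) :=
  (C : ConvexCone ℝ V).convex

theorem ProperCone.closure_interior_eq {x : V} (hx : x ∈ interior (C : Set V)) :
    closure (interior (C : Set V)) = C := by
  rw [C.convex_coe.closure_interior_eq_closure_of_nonempty_interior ⟨x, hx⟩,
    C.isClosed.closure_eq]

theorem ProperCone.nonneg_of_interior {x : V} (hx : x ∈ interior (C : Set V)) {f : V → ℝ}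
    (hf : Continuous f) (hpos : ∀ y ∈ interior (C : Set V), 0 ≤ f y) {h : V} (hh : h ∈ C) :
    0 ≤ f h := by
  have hcl : h ∈ closure (interior (C : Set V)) := by
    rw [ProperCone.closure_interior_eq hx]; exact hh
  exact closure_minimal (t := {y | 0 ≤ f y}) hpos (isClosed_le continuous_const hf) hcl

theorem ProperCone.ray_mem_interior {x h : V} (hx : x ∈ interior (C : Set V)) (hh : h ∈ C)
    {t : ℝ} (ht : 0 ≤ t) : x + t • h ∈ interior (C : Set V) :=
  ProperCone.add_mem_interior hx (C.smul_mem hh ht)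

end Cone

/-! ### Derivatives up to order three and their symmetries. -/

section Smooth

variable {V : Type*} [NormedAddCommGroup V] [NormedSpace ℝ V]

theorem hasDerivAt_add_smul (x h : V) (t : ℝ) :
    HasDerivAt (fun t : ℝ => x + t • h) h t := by
  simpa using ((hasDerivAt_id t).smul_const h).const_add x

theorem iteratedFDeriv_three_apply {G : V → ℝ} (x h u v : V) :
    iteratedFDeriv ℝ 3 G x ![h, u, v] = fderiv ℝ (fderiv ℝ (fderiv ℝ G)) x h u v := by
  rw [iteratedFDeriv_succ_apply_right, iteratedFDeriv_two_apply]
  rfl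

variable {U : Set V} {G : V → ℝ}

theorem ContDiffOn.contDiffAt_fderiv (hU : IsOpen U) (hG : ContDiffOn ℝ 3 G U) {x : V}
    (hx : x ∈ U) : ContDiffAt ℝ 2 (fderiv ℝ G) x :=
  (hG.contDiffAt (hU.mem_nhds hx)).fderiv_right (by norm_num)

theorem ContDiffOn.contDiffAt_fderiv_fderiv (hU : IsOpen U) (hG : ContDiffOn ℝ 3 G U) {x : V}
    (hx : x ∈ U) : ContDiffAt ℝ 1 (fderiv ℝ (fderiv ℝ G)) x :=
  (hG.contDiffAt_fderiv hU hx).fderiv_right (by norm_num)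

theorem ContDiffOn.hasFDerivAt_zero (hU : IsOpen U) (hG : ContDiffOn ℝ 3 G U) {x : V}
    (hx : x ∈ U) : HasFDerivAt G (fderiv ℝ G x) x :=
  ((hG.contDiffAt (hU.mem_nhds hx)).differentiableAt (by norm_num)).hasFDerivAt

theorem ContDiffOn.hasFDerivAt_one (hU : IsOpen U) (hG : ContDiffOn ℝ 3 G U) {x : V}
    (hx : x ∈ U) : HasFDerivAt (fderiv ℝ G) (fderiv ℝ (fderiv ℝ G) x) x :=
  ((hG.contDiffAt_fderiv hU hx).differentiableAt (by norm_num)).hasFDerivAt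

theorem ContDiffOn.hasFDerivAt_two (hU : IsOpen U) (hG : ContDiffOn ℝ 3 G U) {x : V}
    (hx : x ∈ U) :
    HasFDerivAt (fderiv ℝ (fderiv ℝ G)) (fderiv ℝ (fderiv ℝ (fderiv ℝ G)) x) x :=
  ((hG.contDiffAt_fderiv_fderiv hU hx).differentiableAt (by norm_num)).hasFDerivAt

theorem ContDiffOn.second_symm (hU : IsOpen U) (hG : ContDiffOn ℝ 3 G U) {x : V}
    (hx : x ∈ U) (h k : V) :
    fderiv ℝ (fderiv ℝ G) x h k = fderiv ℝ (fderiv ℝ G) x k h :=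
  ((hG.contDiffAt (hU.mem_nhds hx)).isSymmSndFDerivAt
    (by simp; norm_num)).eq h k

theorem ContDiffOn.third_symm (hU : IsOpen U) (hG : ContDiffOn ℝ 3 G U) {x : V}
    (hx : x ∈ U) (h k l : V) :
    fderiv ℝ (fderiv ℝ (fderiv ℝ G)) x h k l = fderiv ℝ (fderiv ℝ (fderiv ℝ G)) x k h l :=
  congrArg (· l) (((hG.contDiffAt_fderiv hU hx).isSymmSndFDerivAt (by simp)).eq h k)

theorem ContDiffOn.hasDerivAt_fderiv_line (hU : IsOpen U) (hG : ContDiffOn ℝ 3 G U) {x h : V}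
    (v : V) {t : ℝ} (hx : x + t • h ∈ U) :
    HasDerivAt (fun t : ℝ => fderiv ℝ G (x + t • h) v)
      (fderiv ℝ (fderiv ℝ G) (x + t • h) h v) t := by
  have h1 := (hG.hasFDerivAt_one hU hx).comp_hasDerivAt t (hasDerivAt_add_smul x h t)
  exact (ContinuousLinearMap.apply ℝ ℝ v).hasFDerivAt.comp_hasDerivAt t h1

theorem ContDiffOn.hasDerivAt_fderiv_fderiv_line (hU : IsOpen U) (hG : ContDiffOn ℝ 3 G U)
    {x h : V} (v w : V) {t : ℝ} (hx : x + t • h ∈ U) :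
    HasDerivAt (fun t : ℝ => fderiv ℝ (fderiv ℝ G) (x + t • h) v w)
      (fderiv ℝ (fderiv ℝ (fderiv ℝ G)) (x + t • h) h v w) t := by
  have h1 := ((hG.hasFDerivAt_two hU hx).clm_apply (hasFDerivAt_const v _)).clm_apply
    (hasFDerivAt_const w _)
  simpa [Function.comp_def] using h1.comp_hasDerivAt t (hasDerivAt_add_smul x h t)

end Smooth

/-! ### Monotonicity of the Hessian under negative curvature. -/

section NegativeCurvature

variable {V : Type*} [NormedAddCommGroup V] [NormedSpace ℝ V] {C : ProperCone ℝ V} {G : V → ℝ}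

/-- Along a ray pointing into the cone, the Hessian of a function of negative curvature
decreases. -/
theorem HasNegativeCurvature.antitoneOn (hneg : HasNegativeCurvature C G)
    (hG : ContDiffOn ℝ 3 G (interior (C : Set V))) {x h : V} (hx : x ∈ interior (C : Set V))
    (hh : h ∈ C) (u : V) :
    AntitoneOn (fun t : ℝ => fderiv ℝ (fderiv ℝ G) (x + t • h) u u) (Ici 0) := by
  have hd : ∀ t ∈ Ici (0 : ℝ), HasDerivAt (fun t : ℝ => fderiv ℝ (fderiv ℝ G) (x + t • h) u u)
      (fderiv ℝ (fderiv ℝ (fderiv ℝ G)) (x + t • h) h u u) t := fun t ht =>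
    hG.hasDerivAt_fderiv_fderiv_line isOpen_interior u u (ProperCone.ray_mem_interior hx hh ht)
  refine antitoneOn_of_deriv_nonpos (convex_Ici 0)
    (fun t ht => (hd t ht).continuousAt.continuousWithinAt)
    (fun t ht => (hd t (interior_subset ht)).differentiableAt.differentiableWithinAt) ?_
  intro t ht
  rw [(hd t (interior_subset ht)).deriv, ← iteratedFDeriv_three_apply]
  exact hneg _ (ProperCone.ray_mem_interior hx hh (interior_subset ht)) h hh u

/-- The derivative `D³G[h,v,h]` equals `D³G[v,h,h]` by symmetry, so `v` serves as the cone direction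
in the curvature condition; `h ∈ C` keeps the ray in the interior. -/
theorem HasNegativeCurvature.antitoneOn_mixed (hneg : HasNegativeCurvature C G)
    (hG : ContDiffOn ℝ 3 G (interior (C : Set V))) {x h v : V} (hx : x ∈ interior (C : Set V))
    (hh : h ∈ C) (hv : v ∈ C) :
    AntitoneOn (fun t : ℝ => fderiv ℝ (fderiv ℝ G) (x + t • h) v h) (Ici 0) := by
  have hd : ∀ t ∈ Ici (0 : ℝ), HasDerivAt (fun t : ℝ => fderiv ℝ (fderiv ℝ G) (x + t • h) v h)
      (fderiv ℝ (fderiv ℝ (fderiv ℝ G)) (x + t • h) h v h) t := fun t ht =>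
    hG.hasDerivAt_fderiv_fderiv_line isOpen_interior v h (ProperCone.ray_mem_interior hx hh ht)
  refine antitoneOn_of_deriv_nonpos (convex_Ici 0)
    (fun t ht => (hd t ht).continuousAt.continuousWithinAt)
    (fun t ht => (hd t (interior_subset ht)).differentiableAt.differentiableWithinAt) ?_
  intro t ht
  have hmem := ProperCone.ray_mem_interior hx hh (interior_subset ht)
  rw [(hd t (interior_subset ht)).deriv, hG.third_symm isOpen_interior hmem,
    ← iteratedFDeriv_three_apply]
  exact hneg _ hmem v hv h

/-- If `G` has negative curvature and its gradient is homogeneous of degree `-1`, then the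
Hessian of `G` maps the cone into its dual. -/
theorem HasNegativeCurvature.hessian_nonneg (hneg : HasNegativeCurvature C G)
    (hG : ContDiffOn ℝ 3 G (interior (C : Set V)))
    (hhom : ∀ x ∈ interior (C : Set V), ∀ t : ℝ, 0 < t →
      fderiv ℝ G (t • x) = t⁻¹ • fderiv ℝ G x)
    {x h v : V} (hx : x ∈ interior (C : Set V)) (hh : h ∈ C) (hv : v ∈ C) :
    0 ≤ fderiv ℝ (fderiv ℝ G) x h v := by
  -- With `h` interior, `DG` is continuous at `h`, the limit of the rescaled ray `t⁻¹x + h`.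
  refine ProperCone.nonneg_of_interior hx (f := fun h => fderiv ℝ (fderiv ℝ G) x h v)
    (by fun_prop) ?_ hh
  intro h hh
  have hhC : h ∈ C := interior_subset hh
  by_contra! hlt
  set c := fderiv ℝ (fderiv ℝ G) x h v with hc
  have hmem : ∀ t ∈ Ici (0 : ℝ), x + t • h ∈ interior (C : Set V) := fun t ht =>
    ProperCone.ray_mem_interior hx hhC ht
  have hd : ∀ t ∈ Ici (0 : ℝ), HasDerivAt (fun t : ℝ => fderiv ℝ G (x + t • h) v)
      (fderiv ℝ (fderiv ℝ G) (x + t • h) h v) t := fun t ht =>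
    hG.hasDerivAt_fderiv_line isOpen_interior v (hmem t ht)
  have hle : ∀ t ∈ Ici (0 : ℝ), fderiv ℝ (fderiv ℝ G) (x + t • h) h v ≤ c := by
    intro t ht
    have := hneg.antitoneOn_mixed hG hx hhC hv (mem_Ici.2 le_rfl) ht ht
    simp only [zero_smul, add_zero] at this
    rwa [hG.second_symm isOpen_interior (hmem t ht), hc, hG.second_symm isOpen_interior hx]
  have hbound : ∀ t ∈ Ici (0 : ℝ),
      fderiv ℝ G (x + t • h) v ≤ fderiv ℝ G x v + c * t := by
    intro t ht
    have := (convex_Ici (0 : ℝ)).image_sub_le_mul_sub_of_deriv_le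
      (fun t ht => (hd t ht).continuousAt.continuousWithinAt)
      (fun t ht => (hd t (interior_subset ht)).differentiableAt.differentiableWithinAt)
      (C := c) (fun t ht => by
        rw [(hd t (interior_subset ht)).deriv]; exact hle t (interior_subset ht))
      0 (mem_Ici.2 le_rfl) t ht ht
    simp only [zero_smul, add_zero, sub_zero] at this
    linarith
  -- By homogeneity `DG(x+th) = t⁻¹ DG(t⁻¹x+h)`, where the second factor tends to `DG(h)`.
  have hlim : Tendsto (fun t : ℝ => fderiv ℝ G (x + t • h) v) atTop (𝓝 0) := by
    have hinv : Tendsto (fun t : ℝ => t⁻¹) atTop (𝓝 0) := tendsto_inv_atTop_zero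
    have h1 : Tendsto (fun t : ℝ => t⁻¹ • x + h) atTop (𝓝 h) := by
      simpa using (hinv.smul_const x).add_const h
    have h2 := ((hG.contDiffAt_fderiv isOpen_interior hh).continuousAt.tendsto).comp h1
    have h3 : Tendsto (fun t : ℝ => t⁻¹ * fderiv ℝ G (t⁻¹ • x + h) v) atTop (𝓝 0) := by
      simpa using hinv.mul (((ContinuousLinearMap.apply ℝ ℝ v).continuous.tendsto _).comp h2)
    refine h3.congr' ?_
    filter_upwards [eventually_gt_atTop (0 : ℝ)] with t ht
    have hm : t⁻¹ • x + h ∈ interior (C : Set V) :=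
      ProperCone.add_mem_interior (ProperCone.smul_mem_interior hx (inv_pos.2 ht)) hhC
    have := hhom _ hm t ht
    rw [smul_add, smul_smul, mul_inv_cancel₀ ht.ne', one_smul] at this
    rw [this]; rfl
  have hbot : Tendsto (fun t : ℝ => fderiv ℝ G x v + c * t) atTop atBot :=
    tendsto_atBot_add_const_left _ _ (tendsto_id.const_mul_atTop_of_neg hlt)
  have := tendsto_atBot_mono' _
    ((eventually_ge_atTop (0 : ℝ)).mono fun t ht => hbound t ht) hbot
  exact not_tendsto_nhds_of_tendsto_atBot this _ hlim

end NegativeCurvature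

/-! ### Convex functions, semidefinite forms and existence of minimizers. -/

section Convexity

variable {V : Type*} [NormedAddCommGroup V] [NormedSpace ℝ V] {U : Set V} {G : V → ℝ}

theorem ConvexOn.add_fderiv_le (hconv : ConvexOn ℝ U G) {x y : V} (hx : x ∈ U) (hy : y ∈ U)
    (hG : DifferentiableAt ℝ G x) : G x + fderiv ℝ G x (y - x) ≤ G y := by
  have hd : HasDerivAt (fun t : ℝ => G (x + t • (y - x))) (fderiv ℝ G x (y - x)) 0 := by
    have h0 : HasFDerivAt G (fderiv ℝ G x) (x + (0 : ℝ) • (y - x)) := by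
      simpa using hG.hasFDerivAt
    exact h0.comp_hasDerivAt 0 (hasDerivAt_add_smul x (y - x) 0)
  have hc : ConvexOn ℝ (Icc (0 : ℝ) 1) (fun t : ℝ => G (x + t • (y - x))) := by
    have := hconv.comp_affineMap (AffineMap.lineMap x y)
    refine (this.subset ?_ (convex_Icc 0 1)).congr fun t _ => ?_
    · intro t ht
      exact hconv.1.lineMap_mem hx hy ht
    · simp [AffineMap.lineMap_apply, add_comm]
  have := hc.le_slope_of_hasDerivAt (x := 0) (y := 1) (by simp) (by simp) one_pos hd
  simp [slope_def_field] at this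
  rw [map_sub]
  linarith

theorem ConvexOn.hessian_nonneg (hU : IsOpen U) (hconv : ConvexOn ℝ U G)
    (hG : ContDiffOn ℝ 3 G U) {x : V} (hx : x ∈ U) (h : V) :
    0 ≤ fderiv ℝ (fderiv ℝ G) x h h := by
  have hd : HasDerivAt (fun t : ℝ => fderiv ℝ G (x + t • h) h)
      (fderiv ℝ (fderiv ℝ G) x h h) 0 := by
    have := hG.hasDerivAt_fderiv_line hU (x := x) (h := h) h (t := 0) (by simpa using hx)
    simpa using this
  have hlim := hd.tendsto_slope_zero_right
  refine ge_of_tendsto hlim ?_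
  have hcont : ContinuousAt (fun t : ℝ => x + t • h) 0 := by fun_prop
  have hmem : ∀ᶠ t : ℝ in 𝓝 0, x + t • h ∈ U :=
    hcont.eventually_mem (hU.mem_nhds (by simpa using hx))
  filter_upwards [self_mem_nhdsWithin, nhdsWithin_le_nhds hmem] with t ht htU
  have h1 := hconv.add_fderiv_le hx htU (hG.hasFDerivAt_zero hU hx).differentiableAt
  have h2 := hconv.add_fderiv_le htU hx (hG.hasFDerivAt_zero hU htU).differentiableAt
  have e : x - (x + t • h) = -(t • h) := by abel
  simp only [add_sub_cancel_left, e, map_neg, map_smul, smul_eq_mul] at h1 h2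
  simp only [zero_add, zero_smul, add_zero, smul_eq_mul]
  have ht' : 0 < t := ht
  refine mul_nonneg (inv_nonneg.2 ht'.le) ?_
  by_contra! hlt
  nlinarith

/-- An isotropic vector of a positive semidefinite form lies in its kernel. -/
theorem ContinuousLinearMap.apply_eq_zero_of_isotropic (B : V →L[ℝ] V →L[ℝ] ℝ)
    (hsymm : ∀ h k, B h k = B k h) (hpos : ∀ h, 0 ≤ B h h) {h : V} (hh : B h h = 0) (k : V) :
    B h k = 0 := by
  by_contra hne
  -- This `c` makes the form equal to `-1` at `k + c • h`.
  obtain ⟨c, hc⟩ : ∃ c : ℝ, c * B h k = -(B k k + 1) / 2 := ⟨_, div_mul_cancel₀ _ hne⟩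
  have := hpos (k + c • h)
  simp only [map_add, map_smul, add_apply, smul_apply, smul_eq_mul, hh, hsymm k h] at this
  linarith

/-- A continuous coercive function on the interior of a closed set, tending to infinity at the
boundary, attains its minimum. -/
theorem exists_isMinOn_interior [FiniteDimensional ℝ V] {K : Set V} (hK : IsClosed K) {g : V → ℝ}
    {e : V} (he : e ∈ interior K) (hcont : ContinuousOn g (interior K))
    (htop : ∀ x ∈ frontier K, Tendsto g (𝓝[interior K] x) atTop) {a c : ℝ} (ha : 0 < a)
    (hcoer : ∀ x ∈ interior K, a * ‖x‖ - c ≤ g x) :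
    ∃ x ∈ interior K, IsMinOn g (interior K) x := by
  have := FiniteDimensional.proper ℝ V
  set S := {x ∈ interior K | g x ≤ g e} with hS
  have hclosed : IsClosed S := by
    refine isClosed_of_closure_subset fun x hx => ?_
    have hne : (𝓝[S] x).NeBot := mem_closure_iff_nhdsWithin_neBot.1 hx
    have hle : 𝓝[S] x ≤ 𝓝[interior K] x := nhdsWithin_mono x fun y hy => hy.1
    have hS' : ∀ᶠ y in 𝓝[S] x, g y ≤ g e :=
      (eventually_mem_nhdsWithin (s := S)).mono fun y hy => hy.2
    have hxK : x ∈ K := closure_minimal (fun y hy => interior_subset hy.1) hK hx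
    by_cases hxi : x ∈ interior K
    · exact ⟨hxi, le_of_tendsto ((hcont x hxi).mono_left hle) hS'⟩
    · have hfr : x ∈ frontier K := ⟨subset_closure hxK, hxi⟩
      have h2 := (htop x hfr).mono_left hle
      obtain ⟨y, hy1, hy2⟩ := ((h2.eventually_gt_atTop (g e)).and hS').exists
      exact absurd hy2 (not_le.2 hy1)
  have hbdd : S ⊆ Metric.closedBall 0 ((g e + c) / a) := by
    intro x hx
    rw [mem_closedBall_zero_iff, le_div_iff₀ ha]
    have := hcoer x hx.1
    linarith [hx.2]
  have hcomp : IsCompact S := (isCompact_closedBall _ _).of_isClosed_subset hclosed hbdd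
  obtain ⟨x, hx, hmin⟩ := hcomp.exists_isMinOn ⟨e, he, le_rfl⟩ (hcont.mono fun y hy => hy.1)
  refine ⟨x, hx.1, fun y hy => ?_⟩
  by_cases hye : g y ≤ g e
  · exact hmin ⟨hy, hye⟩
  · exact hx.2.trans (not_le.1 hye).le

end Convexity

/-! ### Coercivity of interior dual functionals, and biduality. -/

section DualCone

variable {E : Type*} [NormedAddCommGroup E] [NormedSpace ℝ E] [FiniteDimensional ℝ E]
  {K : ProperCone ℝ E}

/-- Subtracting from `s` a small multiple of a norming functional of `x` stays in the dual cone. The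
resulting coercivity drives both minimizations below. -/
theorem exists_mul_norm_le_of_mem_interior_dualCone {s : StrongDual ℝ E}
    (hs : s ∈ interior (dualCone K : Set (StrongDual ℝ E))) :
    ∃ a : ℝ, 0 < a ∧ ∀ x ∈ K, a * ‖x‖ ≤ s x := by
  obtain ⟨r, hr, hball⟩ := Metric.isOpen_iff.1 isOpen_interior s hs
  refine ⟨r / 2, by positivity, fun x hx => ?_⟩
  obtain ⟨g, hg1, hg2⟩ := exists_dual_vector'' ℝ x
  have hmem : s - (r / 2) • g ∈ Metric.ball s r := by
    rw [mem_ball_iff_norm, sub_sub_cancel_left, norm_neg, norm_smul,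
      Real.norm_of_nonneg (by positivity)]
    nlinarith
  have := (mem_dualCone K _).1 (interior_subset (hball hmem)) x hx
  simp [hg2] at this
  linarith

theorem mem_of_forall_dualCone {x : E} (hx : ∀ s ∈ dualCone K, 0 ≤ s x) : x ∈ K := by
  by_contra hxK
  obtain ⟨f, hf1, hf2⟩ := ProperCone.hyperplane_separation_point K hxK
  exact absurd (hx f ((mem_dualCone K f).2 hf1)) (not_le.2 hf2)

end DualCone

/-! ### Consequences of logarithmic homogeneity. -/

namespace IsNormalBarrier

variable {E : Type*} [NormedAddCommGroup E] [NormedSpace ℝ E] {K : ProperCone ℝ E} {ν : ℝ}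
  {F : E → ℝ}

theorem fderiv_smul (hF : IsNormalBarrier K ν F) {x : E} (hx : x ∈ interior (K : Set E)) {t : ℝ}
    (ht : 0 < t) : fderiv ℝ F (t • x) = t⁻¹ • fderiv ℝ F x := by
  have h1 : HasFDerivAt (fun y => F (t • y)) (t • fderiv ℝ F (t • x)) x := by
    rw [show t • fderiv ℝ F (t • x) =
      (fderiv ℝ F (t • x)).comp (t • ContinuousLinearMap.id ℝ E) by ext; simp]
    exact (hF.selfConcordant.contDiffOn.hasFDerivAt_zero isOpen_interior
      (ProperCone.smul_mem_interior hx ht)).comp x ((hasFDerivAt_id x).const_smul t)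
  have h2 : HasFDerivAt (fun y => F (t • y)) (fderiv ℝ F x) x := by
    refine ((hF.selfConcordant.contDiffOn.hasFDerivAt_zero isOpen_interior hx).sub_const
      (ν * Real.log t)).congr_of_eventuallyEq ?_
    filter_upwards [isOpen_interior.mem_nhds hx] with y hy
    exact hF.logHomogeneous y hy t ht
  rw [← h1.unique h2, smul_smul, inv_mul_cancel₀ ht.ne', one_smul]

theorem fderiv_fderiv_smul (hF : IsNormalBarrier K ν F) {x : E} (hx : x ∈ interior (K : Set E))
    {t : ℝ} (ht : 0 < t) :
    t • fderiv ℝ (fderiv ℝ F) (t • x) = t⁻¹ • fderiv ℝ (fderiv ℝ F) x := by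
  have h1 : HasFDerivAt (fun y => fderiv ℝ F (t • y)) (t • fderiv ℝ (fderiv ℝ F) (t • x)) x := by
    rw [show t • fderiv ℝ (fderiv ℝ F) (t • x) =
      (fderiv ℝ (fderiv ℝ F) (t • x)).comp (t • ContinuousLinearMap.id ℝ E) by ext; simp]
    exact (hF.selfConcordant.contDiffOn.hasFDerivAt_one isOpen_interior
      (ProperCone.smul_mem_interior hx ht)).comp x ((hasFDerivAt_id x).const_smul t)
  have h2 : HasFDerivAt (fun y => fderiv ℝ F (t • y)) (t⁻¹ • fderiv ℝ (fderiv ℝ F) x) x := by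
    refine ((hF.selfConcordant.contDiffOn.hasFDerivAt_one isOpen_interior hx).const_smul
      t⁻¹).congr_of_eventuallyEq ?_
    filter_upwards [isOpen_interior.mem_nhds hx] with y hy
    exact hF.fderiv_smul hy ht
  exact h1.unique h2

theorem fderiv_apply_self (hF : IsNormalBarrier K ν F) {x : E}
    (hx : x ∈ interior (K : Set E)) : fderiv ℝ F x x = -ν := by
  have h0 : HasFDerivAt F (fderiv ℝ F x) ((1 : ℝ) • x) := by
    simpa using hF.selfConcordant.contDiffOn.hasFDerivAt_zero isOpen_interior hx
  have h1 : HasDerivAt (fun t : ℝ => F (t • x)) (fderiv ℝ F x x) 1 := by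
    have := h0.comp_hasDerivAt (1 : ℝ) ((hasDerivAt_id (1 : ℝ)).smul_const x)
    simpa [Function.comp_def] using this
  have h2 : HasDerivAt (fun t : ℝ => F (t • x)) (-ν) 1 := by
    have h3 : HasDerivAt (fun t : ℝ => F x - ν * Real.log t) (-ν) 1 := by
      simpa using ((Real.hasDerivAt_log one_ne_zero).const_mul ν).const_sub (F x)
    refine h3.congr_of_eventuallyEq ?_
    filter_upwards [lt_mem_nhds (zero_lt_one' ℝ)] with t ht
    exact hF.logHomogeneous x hx t ht
  exact h1.unique h2

theorem hessian_apply_self (hF : IsNormalBarrier K ν F) {x : E}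
    (hx : x ∈ interior (K : Set E)) :
    fderiv ℝ (fderiv ℝ F) x x = -fderiv ℝ F x := by
  have h0 : HasFDerivAt (fderiv ℝ F) (fderiv ℝ (fderiv ℝ F) x) ((1 : ℝ) • x) := by
    simpa using hF.selfConcordant.contDiffOn.hasFDerivAt_one isOpen_interior hx
  have h1 : HasDerivAt (fun t : ℝ => fderiv ℝ F (t • x)) (fderiv ℝ (fderiv ℝ F) x x) 1 := by
    have := h0.comp_hasDerivAt (1 : ℝ) ((hasDerivAt_id (1 : ℝ)).smul_const x)
    simpa [Function.comp_def] using this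
  have h2 : HasDerivAt (fun t : ℝ => fderiv ℝ F (t • x)) (-fderiv ℝ F x) 1 := by
    have h3 : HasDerivAt (fun t : ℝ => t⁻¹ • fderiv ℝ F x) (-fderiv ℝ F x) 1 := by
      simpa using (hasDerivAt_inv (one_ne_zero (α := ℝ))).smul_const (fderiv ℝ F x)
    refine h3.congr_of_eventuallyEq ?_
    filter_upwards [lt_mem_nhds (zero_lt_one' ℝ)] with t ht
    exact hF.fderiv_smul hx ht
  exact h1.unique h2

theorem add_fderiv_le (hF : IsNormalBarrier K ν F) {x y : E} (hx : x ∈ interior (K : Set E))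
    (hy : y ∈ interior (K : Set E)) : F x + fderiv ℝ F x y + ν ≤ F y := by
  have := hF.selfConcordant.convexOn.add_fderiv_le hx hy
    (hF.selfConcordant.contDiffOn.hasFDerivAt_zero isOpen_interior hx).differentiableAt
  rw [map_sub, hF.fderiv_apply_self hx] at this
  linarith

/-- The tangent bound at `x`, evaluated at `th`, compares the linear term `t DF(x)[h]` with `F(h) -
ν log t`; dividing by `t` rules out a positive slope. -/
theorem neg_fderiv_nonneg (hF : IsNormalBarrier K ν F) {x h : E}
    (hx : x ∈ interior (K : Set E)) (hh : h ∈ K) : 0 ≤ -fderiv ℝ F x h := by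
  refine ProperCone.nonneg_of_interior hx (f := fun h => -fderiv ℝ F x h) (by fun_prop) ?_ hh
  intro h hh
  by_contra! hlt
  have hpos : 0 < fderiv ℝ F x h := by linarith
  have hbound : ∀ᶠ t : ℝ in atTop,
      fderiv ℝ F x h ≤ (F h - F x - ν) * t⁻¹ - ν * (Real.log t / t) := by
    filter_upwards [eventually_gt_atTop (0 : ℝ)] with t ht
    have := hF.add_fderiv_le hx (ProperCone.smul_mem_interior hh ht)
    rw [hF.logHomogeneous h hh t ht, map_smul, smul_eq_mul] at this
    field_simp
    linarith
  have hlog : Tendsto (fun t : ℝ => Real.log t / t) atTop (𝓝 0) :=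
    Real.isLittleO_log_id_atTop.tendsto_div_nhds_zero
  have hlim : Tendsto (fun t : ℝ => (F h - F x - ν) * t⁻¹ - ν * (Real.log t / t)) atTop (𝓝 0) := by
    simpa using (tendsto_inv_atTop_zero.const_mul (F h - F x - ν)).sub (hlog.const_mul ν)
  linarith [ge_of_tendsto hlim hbound]

end IsNormalBarrier

/-! ### Nondegeneracy of the Hessian. -/

namespace IsNormalBarrier

section Nondegenerate

variable {E : Type*} [NormedAddCommGroup E] [NormedSpace ℝ E] {K : ProperCone ℝ E} {ν : ℝ}
  {F : E → ℝ}

/-- For a barrier of negative curvature, the kernel of the Hessian does not depend on the base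
point. -/
theorem hessian_isotropic (hF : IsNormalBarrier K ν F) (hneg : HasNegativeCurvature K F)
    {x z h : E} (hx : x ∈ interior (K : Set E)) (hz : z ∈ interior (K : Set E))
    (hh : fderiv ℝ (fderiv ℝ F) x h h = 0) : fderiv ℝ (fderiv ℝ F) z h h = 0 := by
  have hG := hF.selfConcordant.contDiffOn
  -- Write `z = tx + k` with `k` in the interior: the Hessian at `z` is then dominated by the one at
  -- `tx`, a multiple of the one at `x`.
  obtain ⟨t, ht, hmem⟩ : ∃ t : ℝ, 0 < t ∧ z + t • (-x) ∈ interior (K : Set E) := by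
    have hcont : ContinuousAt (fun t : ℝ => z + t • (-x)) 0 := by fun_prop
    have hev : ∀ᶠ t : ℝ in 𝓝 0, z + t • (-x) ∈ interior (K : Set E) :=
      hcont.eventually_mem (isOpen_interior.mem_nhds (by simpa using hz))
    obtain ⟨t, h1, h2⟩ :=
      ((eventually_mem_nhdsWithin (s := Ioi (0 : ℝ)) (a := 0)).and
        (nhdsWithin_le_nhds hev)).exists
    exact ⟨t, h1, h2⟩
  have hanti := hneg.antitoneOn hG (ProperCone.smul_mem_interior hx ht) (interior_subset hmem) h
    (mem_Ici.2 le_rfl) (mem_Ici.2 zero_le_one) zero_le_one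
  have e : t • x + (1 : ℝ) • (z + t • (-x)) = z := by simp
  simp only [e, zero_smul, add_zero] at hanti
  have hscale := congrArg (fun B : E →L[ℝ] E →L[ℝ] ℝ => B h h) (hF.fderiv_fderiv_smul hx ht)
  simp only [smul_apply, hh, smul_eq_mul, mul_zero] at hscale
  have h0 : fderiv ℝ (fderiv ℝ F) (t • x) h h = 0 := by
    rcases mul_eq_zero.1 hscale with h | h
    · exact absurd h ht.ne'
    · exact h
  exact le_antisymm (h0 ▸ hanti)
    (hF.selfConcordant.convexOn.hessian_nonneg isOpen_interior hG hz h)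

theorem mem_of_line_subset {x h : E} (hline : ∀ t : ℝ, x + t • h ∈ K) : h ∈ K := by
  have hlim : Tendsto (fun t : ℝ => t⁻¹ • x + h) atTop (𝓝 h) := by
    simpa using ((tendsto_inv_atTop_zero (𝕜 := ℝ)).smul_const x).add_const h
  refine K.isClosed.mem_of_tendsto hlim ?_
  filter_upwards [eventually_gt_atTop (0 : ℝ)] with t ht
  have := K.smul_mem (hline t) (inv_pos.2 ht).le
  rwa [smul_add, smul_smul, inv_mul_cancel₀ ht.ne', one_smul] at this

/-- The Hessian of a normal barrier of negative curvature for a regular cone is nondegenerate. -/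
theorem hessian_nondegenerate (hK : IsRegularCone K) (hF : IsNormalBarrier K ν F)
    (hneg : HasNegativeCurvature K F) {x h : E} (hx : x ∈ interior (K : Set E))
    (hh : fderiv ℝ (fderiv ℝ F) x h h = 0) : h = 0 := by
  have hG := hF.selfConcordant.contDiffOn
  -- Since `D²F(z)z = -DF(z)`, the kernel of the Hessian lies in that of the gradient.
  have hgrad : ∀ z ∈ interior (K : Set E), fderiv ℝ F z h = 0 := by
    intro z hz
    have h1 := ContinuousLinearMap.apply_eq_zero_of_isotropic (fderiv ℝ (fderiv ℝ F) z)
      (hG.second_symm isOpen_interior hz)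
      (hF.selfConcordant.convexOn.hessian_nonneg isOpen_interior hG hz)
      (hF.hessian_isotropic hneg hx hz hh) z
    rw [hG.second_symm isOpen_interior hz, hF.hessian_apply_self hz] at h1
    simpa using h1
  have hbound : ∀ t : ℝ, x + t • h ∈ interior (K : Set E) → F (x + t • h) ≤ F x := by
    intro t ht
    have := hF.add_fderiv_le ht hx
    have h2 := hF.fderiv_apply_self ht
    rw [map_add, map_smul, hgrad _ ht, smul_zero, add_zero] at h2
    linarith
  set S : Set ℝ := {t | x + t • h ∈ interior (K : Set E)} with hS
  have hcont : Continuous fun t : ℝ => x + t • h := by fun_prop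
  have hSopen : IsOpen S := isOpen_interior.preimage hcont
  -- `F` is bounded above along the line but blows up at the boundary, so the line never leaves the
  -- interior.
  have hSclosed : IsClosed S := by
    refine isClosed_of_closure_subset fun t ht => ?_
    by_contra htS
    have hne : (𝓝[S] t).NeBot := mem_closure_iff_nhdsWithin_neBot.1 ht
    have hmaps : Tendsto (fun t : ℝ => x + t • h) (𝓝[S] t)
        (𝓝[interior (K : Set E)] (x + t • h)) :=
      hcont.continuousWithinAt.tendsto_nhdsWithin fun _ hu => hu
    have hcl : x + t • h ∈ closure (K : Set E) :=
      closure_mono interior_subset (hcont.continuousWithinAt.mem_closure ht fun _ hu => hu)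
    have htop := (hF.selfConcordant.tendsto_atTop _ ⟨hcl, htS⟩).comp hmaps
    obtain ⟨u, hu1, hu2⟩ := ((htop.eventually_gt_atTop (F x)).and
      (eventually_mem_nhdsWithin (s := S))).exists
    exact absurd (hbound u hu2) (not_le.2 hu1)
  have huniv : S = univ := IsClopen.eq_univ ⟨hSclosed, hSopen⟩ ⟨0, by simpa [hS] using hx⟩
  have hline : ∀ t : ℝ, x + t • h ∈ K := fun t =>
    interior_subset (show t ∈ S by rw [huniv]; trivial)
  refine hK.salient h (mem_of_line_subset hline) (mem_of_line_subset (x := x) fun t => ?_)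
  simpa using hline (-t)

theorem hasFDerivAt_neg_fderiv (hF : IsNormalBarrier K ν F) {x : E}
    (hx : x ∈ interior (K : Set E)) {H : E ≃L[ℝ] StrongDual ℝ E}
    (hH : (H : E →L[ℝ] StrongDual ℝ E) = fderiv ℝ (fderiv ℝ F) x) :
    HasFDerivAt (fun y => -fderiv ℝ F y)
      ((H.trans (ContinuousLinearEquiv.neg ℝ) : E ≃L[ℝ] StrongDual ℝ E) :
        E →L[ℝ] StrongDual ℝ E) x := by
  have := (hF.selfConcordant.contDiffOn.hasFDerivAt_one isOpen_interior hx).neg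
  rw [← hH] at this
  exact this

/-- The tangent bound at `w` gives `-DF(w)[x] ≥ F(w) + ν - F(x)`. -/
theorem tendsto_neg_fderiv_frontier (hF : IsNormalBarrier K ν F) {x z : E}
    (hx : x ∈ interior (K : Set E)) (hz : z ∈ frontier (K : Set E)) :
    Tendsto (fun w => -fderiv ℝ F w x) (𝓝[interior (K : Set E)] z) atTop := by
  refine tendsto_atTop_mono' _ ?_
    (tendsto_atTop_add_const_right _ (ν - F x) (hF.selfConcordant.tendsto_atTop z hz))
  filter_upwards [self_mem_nhdsWithin] with w hw
  have := hF.add_fderiv_le hw hx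
  linarith

theorem dualBarrier_neg_fderiv (hF : IsNormalBarrier K ν F) {x : E}
    (hx : x ∈ interior (K : Set E)) :
    dualBarrier K F (-fderiv ℝ F x) = fderiv ℝ F x x - F x := by
  refine IsGreatest.csSup_eq ⟨⟨x, hx, by simp⟩, ?_⟩
  rintro _ ⟨y, hy, rfl⟩
  have := hF.add_fderiv_le hx hy
  rw [hF.fderiv_apply_self hx]
  simp only [neg_apply, neg_neg]
  linarith

end Nondegenerate

/-! ### The gradient map onto the interior of the dual cone. -/

variable {E : Type*} [NormedAddCommGroup E] [NormedSpace ℝ E] [FiniteDimensional ℝ E]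
  {K : ProperCone ℝ E} {ν : ℝ} {F : E → ℝ}

theorem exists_hessian_equiv (hK : IsRegularCone K) (hF : IsNormalBarrier K ν F)
    (hneg : HasNegativeCurvature K F) {x : E} (hx : x ∈ interior (K : Set E)) :
    ∃ H : E ≃L[ℝ] StrongDual ℝ E, (H : E →L[ℝ] StrongDual ℝ E) = fderiv ℝ (fderiv ℝ F) x := by
  have hinj : Function.Injective (fderiv ℝ (fderiv ℝ F) x).toLinearMap := by
    refine (injective_iff_map_eq_zero _).2 fun h hh => ?_
    refine hF.hessian_nondegenerate hK hneg hx ?_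
    have := congrArg (fun f : StrongDual ℝ E => f h) hh
    simpa using this
  have hdim : Module.finrank ℝ E = Module.finrank ℝ (StrongDual ℝ E) :=
    (Subspace.dual_finrank_eq (K := ℝ) (V := E)).symm.trans
      (LinearMap.toContinuousLinearMap (𝕜 := ℝ) (E := E) (F' := ℝ)).finrank_eq
  refine ⟨(LinearEquiv.ofInjectiveOfFinrankEq _ hinj hdim).toContinuousLinearEquiv, ?_⟩
  ext; rfl

/-- The negative gradient maps the interior of the cone into the interior of the dual cone. -/
theorem neg_fderiv_mem_interior (hK : IsRegularCone K) (hF : IsNormalBarrier K ν F)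
    (hneg : HasNegativeCurvature K F) {x : E} (hx : x ∈ interior (K : Set E)) :
    -fderiv ℝ F x ∈ interior (dualCone K : Set (StrongDual ℝ E)) := by
  obtain ⟨H, hH⟩ := hF.exists_hessian_equiv hK hneg hx
  have hc : ContDiffAt ℝ 2 (fun y => -fderiv ℝ F y) x :=
    (hF.selfConcordant.contDiffOn.contDiffAt_fderiv isOpen_interior hx).neg
  -- By the inverse function theorem, the image of a neighbourhood of `x` is a neighbourhood of
  -- `-DF(x)`.
  have hmap := (hc.hasStrictFDerivAt' (hF.hasFDerivAt_neg_fderiv hx hH)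
    (by norm_num)).map_nhds_eq_of_equiv
  rw [mem_interior_iff_mem_nhds, ← hmap]
  refine eventually_map.2 ?_
  filter_upwards [isOpen_interior.mem_nhds hx] with y hy
  exact (mem_dualCone K _).2 fun h hh => hF.neg_fderiv_nonneg hy hh

/-- The negative gradient is onto the interior of the dual cone. -/
theorem exists_neg_fderiv_eq (hK : IsRegularCone K) (hF : IsNormalBarrier K ν F)
    {s : StrongDual ℝ E} (hs : s ∈ interior (dualCone K : Set (StrongDual ℝ E))) :
    ∃ x ∈ interior (K : Set E), -fderiv ℝ F x = s := by
  have hG := hF.selfConcordant.contDiffOn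
  obtain ⟨e, he⟩ := hK.interior_nonempty
  obtain ⟨a, ha, hsa⟩ := exists_mul_norm_le_of_mem_interior_dualCone hs
  -- Scaling `e` up shrinks the gradient to norm at most `a / 2`, so the tangent bound at `t • e`
  -- costs at most half the coercivity of `s`.
  set t : ℝ := 2 * (‖fderiv ℝ F e‖ + 1) / a with ht
  have htpos : 0 < t := by positivity
  have hte := ProperCone.smul_mem_interior he htpos
  have hnorm : ‖fderiv ℝ F (t • e)‖ ≤ a / 2 := by
    rw [hF.fderiv_smul he htpos, norm_smul, Real.norm_of_nonneg (by positivity),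
      inv_mul_le_iff₀ htpos, ht]
    field_simp
    linarith
  obtain ⟨x, hx, hmin⟩ := exists_isMinOn_interior K.isClosed (g := fun x => s x + F x) he
    (s.continuous.continuousOn.add hG.continuousOn)
    (fun z hz => tendsto_atTop_add_left_of_le' _ (s z - 1) (by
      have : ∀ᶠ w in 𝓝 z, s z - 1 < s w :=
        s.continuous.continuousAt.eventually (lt_mem_nhds (by linarith))
      exact nhdsWithin_le_nhds (this.mono fun w hw => hw.le))
      (hF.selfConcordant.tendsto_atTop z hz))
    (a := a / 2) (c := -F (t • e) - ν) (by positivity) (by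
      intro x hx
      have h1 := hsa x (interior_subset hx)
      have h2 := hF.add_fderiv_le hte hx
      have h3 := (fderiv ℝ F (t • e)).le_opNorm x
      have h4 : -(fderiv ℝ F (t • e) x) ≤ ‖fderiv ℝ F (t • e) x‖ := neg_le_abs _
      have h5 := mul_le_mul_of_nonneg_right hnorm (norm_nonneg x)
      linarith)
  refine ⟨x, hx, ?_⟩
  have hd := (s.hasFDerivAt (x := x)).add (hG.hasFDerivAt_zero isOpen_interior hx)
  have := (hmin.isLocalMin (isOpen_interior.mem_nhds hx)).hasFDerivAt_eq_zero hd
  exact (eq_neg_of_add_eq_zero_left this).symm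

/-- Near a point of the interior of the dual cone, the inverse `X` of the negative gradient is
twice continuously differentiable, and the gradient of the dual barrier is `s ↦ -X s`. -/
theorem exists_gradient_inverse (hF : IsNormalBarrier K ν F) {x : E} (hx : x ∈ interior (K : Set E))
    {H : E ≃L[ℝ] StrongDual ℝ E}
    (hH : (H : E →L[ℝ] StrongDual ℝ E) = fderiv ℝ (fderiv ℝ F) x) :
    ∃ X : StrongDual ℝ E → E, X (-fderiv ℝ F x) = x ∧ ContDiffAt ℝ 2 X (-fderiv ℝ F x) ∧
      HasFDerivAt X (-(H.symm : StrongDual ℝ E →L[ℝ] E)) (-fderiv ℝ F x) ∧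
      ∀ᶠ s in 𝓝 (-fderiv ℝ F x),
        HasFDerivAt (dualBarrier K F) (-NormedSpace.inclusionInDoubleDual ℝ E (X s)) s := by
  have hG := hF.selfConcordant.contDiffOn
  have hc : ContDiffAt ℝ 2 (fun y => -fderiv ℝ F y) x :=
    (hG.contDiffAt_fderiv isOpen_interior hx).neg
  have hd := hF.hasFDerivAt_neg_fderiv hx hH
  have hstrict := hc.hasStrictFDerivAt' hd (by norm_num)
  have hX0 : hc.localInverse hd (by norm_num) (-fderiv ℝ F x) = x :=
    hc.localInverse_apply_image hd (by norm_num)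
  have hXc := hc.to_localInverse hd (by norm_num)
  have hXd : HasFDerivAt (hc.localInverse hd (by norm_num)) _ (-fderiv ℝ F x) :=
    hstrict.to_localInverse.hasFDerivAt
  have hXr : ∀ᶠ s in 𝓝 (-fderiv ℝ F x),
      -fderiv ℝ F (hc.localInverse hd (by norm_num) s) = s :=
    hstrict.eventually_right_inverse
  set X := hc.localInverse hd (by norm_num) with hXdef
  have hXint : ∀ᶠ s in 𝓝 (-fderiv ℝ F x), X s ∈ interior (K : Set E) :=
    hXc.continuousAt.eventually_mem (by
      rw [hX0]; exact isOpen_interior.mem_nhds hx)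
  have hXdiff : ∀ᶠ s in 𝓝 (-fderiv ℝ F x), DifferentiableAt ℝ X s :=
    (hXc.eventually (by norm_num)).mono fun s hs => hs.differentiableAt (by norm_num)
  refine ⟨X, hX0, hXc, ?_, ?_⟩
  · exact hXd.congr_fderiv (ContinuousLinearMap.ext fun s => map_neg H.symm s)
  · have hall := (hXr.and (hXint.and hXdiff)).eventually_nhds
    filter_upwards [hall] with s hs
    obtain ⟨hr, hi, hdiff⟩ := hs.self_of_nhds
    have heq : dualBarrier K F =ᶠ[𝓝 s] fun s => -s (X s) - F (X s) := by
      filter_upwards [hs] with u hu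
      have := hF.dualBarrier_neg_fderiv hu.2.1
      rw [hu.1, neg_eq_iff_eq_neg.1 hu.1] at this
      exact this
    have h1 := (hasFDerivAt_id s).clm_apply hdiff.hasFDerivAt
    have h2 := (hG.hasFDerivAt_zero isOpen_interior hi).comp s hdiff.hasFDerivAt
    -- The terms containing the derivative of `X` cancel because `DF(X s) = -s`.
    refine ((h1.neg.sub h2).congr_of_eventuallyEq heq).congr_fderiv ?_
    ext k
    have hr' : ∀ v, fderiv ℝ F (X s) v = -s v := fun v => by
      conv_rhs => rw [← hr]
      simp
    simp [hr']

end IsNormalBarrier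

/-! ### Smoothness and Hessian of the dual barrier; scaling points. -/

namespace IsNormalBarrier

variable {E : Type*} [NormedAddCommGroup E] [NormedSpace ℝ E] [FiniteDimensional ℝ E]
  {K : ProperCone ℝ E} {ν : ℝ} {F : E → ℝ}

theorem fderiv_dualBarrier (hK : IsRegularCone K) (hF : IsNormalBarrier K ν F)
    (hneg : HasNegativeCurvature K F) {x : E} (hx : x ∈ interior (K : Set E)) :
    fderiv ℝ (dualBarrier K F) (-fderiv ℝ F x) = -NormedSpace.inclusionInDoubleDual ℝ E x := by
  obtain ⟨H, hH⟩ := hF.exists_hessian_equiv hK hneg hx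
  obtain ⟨X, hX0, -, -, hX⟩ := hF.exists_gradient_inverse hx hH
  rw [hX.self_of_nhds.fderiv, hX0]

/-- The gradient `s ↦ -X s` is `C²`, one order better than differentiating the formula for the dual
barrier would show. -/
theorem contDiffOn_dualBarrier (hK : IsRegularCone K) (hF : IsNormalBarrier K ν F)
    (hneg : HasNegativeCurvature K F) :
    ContDiffOn ℝ 3 (dualBarrier K F) (interior (dualCone K : Set (StrongDual ℝ E))) := by
  intro s hs
  obtain ⟨x, hx, rfl⟩ := hF.exists_neg_fderiv_eq hK hs
  obtain ⟨H, hH⟩ := hF.exists_hessian_equiv hK hneg hx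
  obtain ⟨X, -, hXc, -, hX⟩ := hF.exists_gradient_inverse hx hH
  refine ContDiffAt.contDiffWithinAt ?_
  refine (contDiffAt_succ_iff_hasFDerivAt (n := 2)).2
    ⟨fun s => -NormedSpace.inclusionInDoubleDual ℝ E (X s), ⟨_, hX, fun s hs => hs⟩, ?_⟩
  exact (contDiffAt_const.clm_apply hXc).neg

theorem hessian_dualBarrier (hK : IsRegularCone K) (hF : IsNormalBarrier K ν F)
    (hneg : HasNegativeCurvature K F) {x : E} (hx : x ∈ interior (K : Set E))
    {H : E ≃L[ℝ] StrongDual ℝ E}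
    (hH : (H : E →L[ℝ] StrongDual ℝ E) = fderiv ℝ (fderiv ℝ F) x) (s r : StrongDual ℝ E) :
    fderiv ℝ (fderiv ℝ (dualBarrier K F)) (-fderiv ℝ F x) s r = r (H.symm s) := by
  obtain ⟨X, -, -, hXd, hX⟩ := hF.exists_gradient_inverse hx hH
  have h1 := ((hF.contDiffOn_dualBarrier hK hneg).hasFDerivAt_one isOpen_interior
    (hF.neg_fderiv_mem_interior hK hneg hx)).clm_apply (hasFDerivAt_const r _)
  have h2 : HasFDerivAt (fun u => fderiv ℝ (dualBarrier K F) u r)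
      (-(r.comp (-(H.symm : StrongDual ℝ E →L[ℝ] E)))) (-fderiv ℝ F x) := by
    refine (r.hasFDerivAt.comp _ hXd).neg.congr_of_eventuallyEq ?_
    filter_upwards [hX] with u hu
    rw [hu.fderiv]
    rfl
  simpa using congrArg (fun f : StrongDual ℝ E →L[ℝ] ℝ => f s) (h1.unique h2)

/-- If both `F` and its dual have negative curvature, the Hessian of `F` at any interior point
maps the cone onto its dual. -/
theorem hessian_mem_dualCone_iff (hK : IsRegularCone K) (hF : IsNormalBarrier K ν F)
    (hneg : HasNegativeCurvature K F)
    (hneg' : HasNegativeCurvature (dualCone K) (dualBarrier K F)) {x : E}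
    (hx : x ∈ interior (K : Set E)) (h : E) :
    fderiv ℝ (fderiv ℝ F) x h ∈ dualCone K ↔ h ∈ K := by
  refine ⟨fun hh => ?_, fun hh => (mem_dualCone K _).2 fun v hv =>
    hneg.hessian_nonneg hF.selfConcordant.contDiffOn (fun x hx t ht => hF.fderiv_smul hx ht)
      hx hh hv⟩
  obtain ⟨H, hH⟩ := hF.exists_hessian_equiv hK hneg hx
  refine mem_of_forall_dualCone fun r hr => ?_
  -- The dual Hessian at `-DF(x)`, applied to `D²F(x)h` and `r`, is `r h`.
  have hpos := hneg'.hessian_nonneg (hF.contDiffOn_dualBarrier hK hneg) ?_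
    (hF.neg_fderiv_mem_interior hK hneg hx) hh hr
  · rw [hF.hessian_dualBarrier hK hneg hx hH, ← hH] at hpos
    simpa using hpos
  · intro s hs t ht
    obtain ⟨z, hz, rfl⟩ := hF.exists_neg_fderiv_eq hK hs
    have hti := inv_pos.2 ht
    have e : t • -fderiv ℝ F z = -fderiv ℝ F (t⁻¹ • z) := by
      rw [hF.fderiv_smul hz hti, inv_inv, smul_neg]
    rw [e, hF.fderiv_dualBarrier hK hneg (ProperCone.smul_mem_interior hz hti),
      hF.fderiv_dualBarrier hK hneg hz, map_smul, smul_neg]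

/-- The scaling point: every pair of interior points of the cone and of its dual is matched by
the Hessian at some interior point. -/
theorem exists_hessian_apply_eq (hF : IsNormalBarrier K ν F) {x : E}
    (hx : x ∈ interior (K : Set E)) {s : StrongDual ℝ E}
    (hs : s ∈ interior (dualCone K : Set (StrongDual ℝ E))) :
    ∃ w ∈ interior (K : Set E), fderiv ℝ (fderiv ℝ F) w x = s := by
  have hG := hF.selfConcordant.contDiffOn
  obtain ⟨a, ha, hsa⟩ := exists_mul_norm_le_of_mem_interior_dualCone hs
  have hd : ∀ w ∈ interior (K : Set E), HasFDerivAt (fun w => s w + -fderiv ℝ F w x)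
      (s + -(fderiv ℝ (fderiv ℝ F) w).flip x) w := fun w hw => by
    have := (hG.hasFDerivAt_one isOpen_interior hw).clm_apply (hasFDerivAt_const x w)
    simpa using (s.hasFDerivAt (x := w)).fun_add this.fun_neg
  -- The term `s w` gives coercivity, the gradient term is nonnegative and blows up at the boundary,
  -- and the critical equation is `D²F(w)x = s`.
  obtain ⟨w, hw, hmin⟩ := exists_isMinOn_interior K.isClosed
    (g := fun w => s w + -fderiv ℝ F w x) hx
    (fun w hw => (hd w hw).continuousAt.continuousWithinAt)
    (fun z hz => tendsto_atTop_add_left_of_le' _ (s z - 1) (by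
      have : ∀ᶠ w in 𝓝 z, s z - 1 < s w :=
        s.continuous.continuousAt.eventually (lt_mem_nhds (by linarith))
      exact nhdsWithin_le_nhds (this.mono fun w hw => hw.le))
      (hF.tendsto_neg_fderiv_frontier hx hz))
    (a := a) (c := 0) ha (fun w hw => by
      have h1 := hsa w (interior_subset hw)
      have h2 := hF.neg_fderiv_nonneg hw (interior_subset hx)
      linarith)
  refine ⟨w, hw, ?_⟩
  have h0 := (hmin.isLocalMin (isOpen_interior.mem_nhds hw)).hasFDerivAt_eq_zero (hd w hw)
  ext k
  have := congrArg (fun f : StrongDual ℝ E => f k) h0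
  simp only [add_apply, neg_apply, ContinuousLinearMap.flip_apply, zero_apply] at this
  rw [hG.second_symm isOpen_interior hw]
  linarith

end IsNormalBarrier

/-! ### Homogeneity and self-duality. -/

theorem mainTheorem11 {E : Type*} [NormedAddCommGroup E] [NormedSpace ℝ E]
    [FiniteDimensional ℝ E] (K : ProperCone ℝ E) (hK : IsRegularCone K)
    (ν : ℝ) (F : E → ℝ) (hF : IsNormalBarrier K ν F)
    (hneg : HasNegativeCurvature K F)
    (hneg' : HasNegativeCurvature (dualCone K) (dualBarrier K F)) :
    IsSymmetricCone K := by
  have hG := hF.selfConcordant.contDiffOn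
  refine ⟨hK, fun x hx y hy => ?_, ?_⟩
  · obtain ⟨w, hw, hwx⟩ :=
      hF.exists_hessian_apply_eq hx (hF.neg_fderiv_mem_interior hK hneg hy)
    obtain ⟨Hw, hHw⟩ := hF.exists_hessian_equiv hK hneg hw
    obtain ⟨Hy, hHy⟩ := hF.exists_hessian_equiv hK hneg hy
    have hw' : ∀ z, Hw z ∈ dualCone K ↔ z ∈ K := fun z => by
      rw [← hF.hessian_mem_dualCone_iff hK hneg hneg' hw, ← hHw]; rfl
    have hy' : ∀ z, Hy z ∈ dualCone K ↔ z ∈ K := fun z => by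
      rw [← hF.hessian_mem_dualCone_iff hK hneg hneg' hy, ← hHy]; rfl
    -- Both Hessians carry `K` onto `K*`, so their quotient is an automorphism of `K`.
    refine ⟨(Hw.trans Hy.symm).toLinearEquiv, ?_, ?_⟩
    · ext z
      constructor
      · rintro ⟨u, hu, rfl⟩
        refine (hy' _).1 ?_
        simpa using (hw' u).2 hu
      · intro hz
        exact ⟨Hw.symm (Hy z), (hw' _).1 (by simpa using (hy' z).2 hz), by simp⟩
    · have h1 : Hw x = Hy y := by
        rw [← hF.hessian_apply_self hy, ← hHw, ← hHy] at hwx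
        exact hwx
      simp [h1]
  · obtain ⟨x, hx⟩ := hK.interior_nonempty
    have hpos := hF.selfConcordant.convexOn.hessian_nonneg isOpen_interior hG hx
    refine ⟨ContinuousLinearMap.coeLM ℝ ∘ₗ (fderiv ℝ (fderiv ℝ F) x).toLinearMap,
      hG.second_symm isOpen_interior hx,
      fun h hh => (hpos h).lt_of_ne fun h0 => hh (hF.hessian_nondegenerate hK hneg hx h0.symm),
      fun y => ?_⟩
    rw [← hF.hessian_mem_dualCone_iff hK hneg hneg' hx, mem_dualCone]
    refine forall₂_congr fun z hz => ?_
    rw [hG.second_symm isOpen_interior hx]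
    rfl
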